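/- Let $C_k$ denote the cycle with $k$ edges and $P_4$ the path with $4$ vertices. For a simple graph $K$ and a graph $\Gamma$, a $(K,\Gamma)$-design is a set of subgraphs of $K$, each isomorphic to $\Gamma$, whose edge sets partition the edge set of $K$; when $K=K_v$ is the complete graph on a set of $v$ vertices it is called a $\Gamma$-design of order $v$. A down-link from a $(K,\Gamma)$-design $\mathcal B$ to a $(K',\Gamma')$-design $\mathcal B'$, where $\Gamma'$ is a subgraph of $\Gamma$, is a map $f:\mathcal B\to\mathcal B'$ such that $f(B)$ is a subgraph of $B$ for every $B\in\mathcal B$. (The vertices of all graphs are taken from one fixed infinite set; the vertex sets of $K$ and $K'$ may overlap in any way.) Let $\mathcal L_1C_k(v)$ be the set of all integers $n$ such that some $C_k$-design of order $v$ has a down-link to a $P_4$-design of order $n$, and let $\mathcal L_2C_k(v)$ be the set of all integers $n$ such that every $C_k$-design of order $v$ has a down-link to some $P_4$-design of order $n$. **Theorem 4.1.** Let $k\ge 9$ and let $v>1$ be such that a $C_k$-design of order $v$ exists. Then $$\Big\{\,n\ge v-\Big\lfloor\frac{k-9}{4}\Big\rfloor \ \Big|\ n\equiv 0,1 \pmod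 3\Big\}\subseteq \mathcal L_2C_k(v)\subseteq \mathcal L_1C_k(v).$$ -/

import Mathlib

namespace DownLink

/-- The complete graph with vertex set `V`, where `V` is a finite set of vertices taken from the
ambient vertex supply `U`. All graphs occurring in designs are subgraphs of the complete graph
on `U`, so that containment between blocks of different designs makes sense. -/
def completeOn {U : Type*} (V : Finset U) : (⊤ : SimpleGraph U).Subgraph :=
  (⊤ : (⊤ : SimpleGraph U).Subgraph).induce (V : Set U)

/-- `𝓑` is a `(K, Γ)`-design: a set of subgraphs of `K`, each isomorphic to `Γ`, whose edge sets
partition the edge set of `K`. -/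
structure IsDesign {U T : Type*} (K : (⊤ : SimpleGraph U).Subgraph) (Γ : SimpleGraph T)
    (𝓑 : Set (⊤ : SimpleGraph U).Subgraph) : Prop where
  le : ∀ B ∈ 𝓑, B ≤ K
  iso : ∀ B ∈ 𝓑, Nonempty (B.coe ≃g Γ)
  partition : ∀ e ∈ K.edgeSet, ∃! B, B ∈ 𝓑 ∧ e ∈ B.edgeSet

/-- `f` is a down-link from the `(K, Γ)`-design `𝓑` to the `(K', Γ')`-design `𝓑'`,
where `Γ'` is (isomorphic to) a subgraph of `Γ`. -/
structure IsDownLink {U T T' : Type*} (K K' : (⊤ : SimpleGraph U).Subgraph)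
    (Γ : SimpleGraph T) (Γ' : SimpleGraph T')
    (𝓑 𝓑' : Set (⊤ : SimpleGraph U).Subgraph) (f : 𝓑 → 𝓑') : Prop where
  source : IsDesign K Γ 𝓑
  target : IsDesign K' Γ' 𝓑'
  contained : Γ'.IsContained Γ
  le : ∀ B : 𝓑, (f B).1 ≤ B.1

/-- `v` is admissible for `Γ`: there is a `Γ`-design of order `v`, and the complete graph on
`v` vertices has at least one edge (so the design is not empty). -/
def Admissible (U : Type*) {T : Type*} (Γ : SimpleGraph T) (v : ℕ) : Prop :=
  1 < v ∧ ∃ V : Finset U, V.card = v ∧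
    ∃ 𝓑 : Set (⊤ : SimpleGraph U).Subgraph, IsDesign (completeOn V) Γ 𝓑

/-- The orders `n` such that some `Γ`-design of order `v` can be down-linked to a `Γ'`-design of
order `n`. -/
def L₁ (U : Type*) {T T' : Type*} (Γ : SimpleGraph T) (Γ' : SimpleGraph T') (v : ℕ) : Set ℕ :=
  {n | ∃ V : Finset U, V.card = v ∧ ∃ 𝓑 : Set (⊤ : SimpleGraph U).Subgraph,
    IsDesign (completeOn V) Γ 𝓑 ∧
    ∃ W : Finset U, W.card = n ∧ ∃ (𝓑' : Set (⊤ : SimpleGraph U).Subgraph) (f : 𝓑 → 𝓑'),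
      IsDownLink (completeOn V) (completeOn W) Γ Γ' 𝓑 𝓑' f}

/-- The orders `n` such that every `Γ`-design of order `v` can be down-linked to a `Γ'`-design of
order `n`. -/
def L₂ (U : Type*) {T T' : Type*} (Γ : SimpleGraph T) (Γ' : SimpleGraph T') (v : ℕ) : Set ℕ :=
  {n | ∀ V : Finset U, V.card = v → ∀ 𝓑 : Set (⊤ : SimpleGraph U).Subgraph,
    IsDesign (completeOn V) Γ 𝓑 →
    ∃ W : Finset U, W.card = n ∧ ∃ (𝓑' : Set (⊤ : SimpleGraph U).Subgraph) (f : 𝓑 → 𝓑'),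
      IsDownLink (completeOn V) (completeOn W) Γ Γ' 𝓑 𝓑' f}

end DownLink

/-! Let the given cycle design live on `V`. Choose a set `W` of order `n` nested with `V`, and two
vertices `x`, `y` of `W`. A vertex meets at most four of the `k` three-edge paths in a `k`-cycle, so
when `4 * (|V \ W| + 2) < k`, which the bound on `n` ensures, every block contains such a path
inside `W \ {x, y}` (`exists_path_avoiding`). These paths are edge-disjoint because the blocks are.

It remains to decompose what they leave of the complete graph on `W`. There `x` and `y` are still
joined to every other vertex and to each other, and the number of edges is a multiple of three since
`n ≡ 0, 1 (mod 3)`. That suffices (`pathDecomposable_cone`): whatever graph `F` remains on the other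
vertices, small pieces of `F` are absorbed together with their edges to `x` and `y` until one of
four small graphs is left. -/

namespace DownLink

/-! ### Decomposing finite edge sets into three-edge paths -/

section PathDecomposable

variable {α : Type*} [DecidableEq α]

/-- The edges of the path `a - b - c - d`. -/
def pathEdges (a b c d : α) : Finset (Sym2 α) := {s(a, b), s(b, c), s(c, d)}

/-- A finite set of edges that can be partitioned into paths with three edges. -/
inductive PathDecomposable : Finset (Sym2 α) → Prop
  | empty : PathDecomposable ∅
  | union {a b c d : α} {E : Finset (Sym2 α)} (hp : [a, b, c, d].Nodup)
      (hd : Disjoint (pathEdges a b c d) E) (hE : PathDecomposable E) :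
      PathDecomposable (pathEdges a b c d ∪ E)

namespace PathDecomposable

theorem path {a b c d : α} (hp : [a, b, c, d].Nodup) :
    PathDecomposable (pathEdges a b c d) := by
  simpa using PathDecomposable.union hp (Finset.disjoint_empty_right _) .empty

theorem disjUnion {E F : Finset (Sym2 α)} (hE : PathDecomposable E) (hF : PathDecomposable F)
    (h : Disjoint E F) : PathDecomposable (E ∪ F) := by
  induction hE with
  | empty => simpa using hF
  | union hp hd _ ih =>
    rw [Finset.disjoint_union_left] at h
    rw [Finset.union_assoc]
    exact .union hp (Finset.disjoint_union_right.2 ⟨hd, h.1⟩) (ih h.2)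

theorem of_sdiff {E F : Finset (Sym2 α)} (hF : PathDecomposable F) (h : F ⊆ E)
    (hE : PathDecomposable (E \ F)) : PathDecomposable E := by
  simpa [Finset.union_sdiff_of_subset h] using hF.disjUnion hE Finset.disjoint_sdiff

end PathDecomposable

theorem card_pathEdges {a b c d : α} (hp : [a, b, c, d].Nodup) :
    (pathEdges a b c d).card = 3 := by
  simp at hp
  rw [pathEdges, Finset.card_eq_three]
  refine ⟨_, _, _, ?_, ?_, ?_, rfl⟩ <;> grind [Sym2.eq_iff]

/-! ### Graphs with two dominating vertices -/

/-- The edges joining `x` and `y` to all vertices in `S`, together with `F`. -/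
def cone (x y : α) (S : Finset α) (F : Finset (Sym2 α)) : Finset (Sym2 α) :=
  S.image (fun a => s(x, a)) ∪ S.image (fun a => s(y, a)) ∪ F

theorem mem_cone {x y : α} {S : Finset α} {F : Finset (Sym2 α)} {e : Sym2 α} :
    e ∈ cone x y S F ↔ (∃ a ∈ S, e = s(x, a)) ∨ (∃ a ∈ S, e = s(y, a)) ∨ e ∈ F := by
  simp only [cone, Finset.mem_union, Finset.mem_image, or_assoc, eq_comm]

/-- Removing the vertices in `T` together with some edges from a cone. -/
theorem pathDecomposable_cone_of_sdiff {x y : α} (hxy : x ≠ y) {S T : Finset α}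
    {F F' : Finset (Sym2 α)} (hx : x ∉ S) (hy : y ∉ S) (hF : ∀ e ∈ F, ∀ w ∈ e, w ∈ S)
    (hT : T ⊆ S) (hF' : F' ⊆ F) (h : PathDecomposable (cone x y T F'))
    (h' : PathDecomposable (insert s(x, y) (cone x y (S \ T) (F \ F')))) :
    PathDecomposable (insert s(x, y) (cone x y S F)) := by
  have key : insert s(x, y) (cone x y S F) \ cone x y T F' =
      insert s(x, y) (cone x y (S \ T) (F \ F')) := by
    ext e
    simp only [Finset.mem_sdiff, Finset.mem_insert, mem_cone]
    constructor
    · rintro ⟨rfl | ⟨a, ha, rfl⟩ | ⟨a, ha, rfl⟩ | he, hn⟩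
      · exact .inl rfl
      · exact .inr (.inl ⟨a, ⟨ha, fun h => hn (.inl ⟨a, h, rfl⟩)⟩, rfl⟩)
      · exact .inr (.inr (.inl ⟨a, ⟨ha, fun h => hn (.inr (.inl ⟨a, h, rfl⟩))⟩, rfl⟩))
      · exact .inr (.inr (.inr ⟨he, fun h => hn (.inr (.inr h))⟩))
    · rintro (rfl | ⟨a, ⟨ha, ha'⟩, rfl⟩ | ⟨a, ⟨ha, ha'⟩, rfl⟩ | ⟨he, he'⟩)
      · refine ⟨.inl rfl, ?_⟩
        have := hF s(x, y)
        simp only [Sym2.mem_iff] at this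
        simp only [Sym2.eq_iff]
        grind
      · refine ⟨.inr (.inl ⟨a, ha, rfl⟩), ?_⟩
        have := hF s(x, a)
        simp only [Sym2.mem_iff] at this
        simp only [Sym2.eq_iff]
        grind
      · refine ⟨.inr (.inr (.inl ⟨a, ha, rfl⟩)), ?_⟩
        have := hF s(y, a)
        simp only [Sym2.mem_iff] at this
        simp only [Sym2.eq_iff]
        grind
      · refine ⟨.inr (.inr (.inr he)), ?_⟩
        rintro (⟨a, _, rfl⟩ | ⟨a, _, rfl⟩ | h)
        · exact hx (hF _ he x (by simp))
        · exact hy (hF _ he y (by simp))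
        · exact he' h
  refine h.of_sdiff ?_ (key ▸ h')
  intro e
  simp only [Finset.mem_insert, mem_cone]
  grind

/-- This and the next two lemmas supply the removable pieces. They leave the edge `xy` unused, so
the remainder is again a cone. Here `z = w` is allowed, so the leaves may share their neighbour. -/
theorem pathDecomposable_cone_pair {x y a b z w : α} (h : [x, y, a, b].Nodup)
    (hz : z ∉ [x, y, a, b]) (hw : w ∉ [x, y, a, b]) :
    PathDecomposable (cone x y {a, b} {s(z, a), s(w, b)}) := by
  simp at h hz hw
  have : cone x y {a, b} {s(z, a), s(w, b)} = pathEdges z a x b ∪ pathEdges w b y a := by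
    apply Finset.Subset.antisymm <;>
      simp [cone, pathEdges, Finset.insert_subset_iff]
  rw [this]
  refine .disjUnion (.path ?_) (.path ?_) ?_
  · simp; grind
  · simp; grind
  · simp [pathEdges]; grind

theorem pathDecomposable_cone_triangle {x y a b c : α} (h : [x, y, a, b, c].Nodup) :
    PathDecomposable (cone x y {a, b, c} {s(a, b), s(b, c), s(c, a)}) := by
  simp at h
  have : cone x y {a, b, c} {s(a, b), s(b, c), s(c, a)} =
      pathEdges a b x c ∪ (pathEdges x a c y ∪ pathEdges c b y a) := by
    apply Finset.Subset.antisymm <;>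
      simp [cone, pathEdges, Finset.insert_subset_iff]
  rw [this]
  refine .disjUnion (.path ?_) (.disjUnion (.path ?_) (.path ?_) ?_) ?_
  · simp; grind
  · simp; grind
  · simp; grind
  · simp [pathEdges]; grind
  · simp [pathEdges]; grind

theorem pathDecomposable_cone_empty_three {x y a b c : α} (h : [x, y, a, b, c].Nodup) :
    PathDecomposable (cone x y {a, b, c} ∅) := by
  simp at h
  have : cone x y {a, b, c} ∅ = pathEdges a x b y ∪ pathEdges x c y a := by
    apply Finset.Subset.antisymm <;>
      simp [cone, pathEdges, Finset.insert_subset_iff]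
  rw [this]
  refine .disjUnion (.path ?_) (.path ?_) ?_
  · simp; grind
  · simp; grind
  · simp [pathEdges]; grind

/-- The terminal configurations start here. The edge `xy` is included, since nothing is left over
afterwards. -/
theorem pathDecomposable_cone_triangle_isolated {x y a b c d : α} (h : [x, y, a, b, c, d].Nodup) :
    PathDecomposable (insert s(x, y) (cone x y {a, b, c, d} {s(a, b), s(b, c), s(c, a)})) := by
  simp at h
  have : insert s(x, y) (cone x y {a, b, c, d} {s(a, b), s(b, c), s(c, a)}) =
      pathEdges d x a b ∪ (pathEdges d y b c ∪ (pathEdges b x c y ∪ pathEdges x y a c)) := by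
    apply Finset.Subset.antisymm <;>
      simp [cone, pathEdges, Finset.insert_subset_iff]
  rw [this]
  refine .disjUnion (.path ?_) (.disjUnion (.path ?_) (.disjUnion (.path ?_) (.path ?_) ?_) ?_) ?_
  · simp; grind
  · simp; grind
  · simp; grind
  · simp; grind
  · simp [pathEdges]; grind
  · simp [pathEdges]; grind
  · simp [pathEdges]; grind

theorem pathDecomposable_cone_star {x y z a b : α} (h : [x, y, z, a, b].Nodup) :
    PathDecomposable (insert s(x, y) (cone x y {z, a, b} {s(z, a), s(z, b)})) := by
  simp at h
  have : insert s(x, y) (cone x y {z, a, b} {s(z, a), s(z, b)}) =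
      pathEdges a z b x ∪ (pathEdges b y x a ∪ pathEdges x z y a) := by
    apply Finset.Subset.antisymm <;>
      simp [cone, pathEdges, Finset.insert_subset_iff]
  rw [this]
  refine .disjUnion (.path ?_) (.disjUnion (.path ?_) (.path ?_) ?_) ?_
  · simp; grind
  · simp; grind
  · simp; grind
  · simp [pathEdges]; grind
  · simp [pathEdges]; grind

theorem pathDecomposable_cone_empty_four {x y a b c d : α} (h : [x, y, a, b, c, d].Nodup) :
    PathDecomposable (insert s(x, y) (cone x y {a, b, c, d} ∅)) := by
  simp at h
  have : insert s(x, y) (cone x y {a, b, c, d} ∅) =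
      pathEdges a x y b ∪ (pathEdges b x c y ∪ pathEdges a y d x) := by
    apply Finset.Subset.antisymm <;>
      simp [cone, pathEdges, Finset.insert_subset_iff]
  rw [this]
  refine .disjUnion (.path ?_) (.disjUnion (.path ?_) (.path ?_) ?_) ?_
  · simp; grind
  · simp; grind
  · simp; grind
  · simp [pathEdges]; grind
  · simp [pathEdges]; grind

theorem pathDecomposable_cone_edge {x y z a : α} (h : [x, y, z, a].Nodup) :
    PathDecomposable (insert s(x, y) (cone x y {z, a} {s(z, a)})) := by
  simp at h
  have : insert s(x, y) (cone x y {z, a} {s(z, a)}) = pathEdges z x y a ∪ pathEdges x a z y := by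
    apply Finset.Subset.antisymm <;>
      simp [cone, pathEdges, Finset.insert_subset_iff]
  rw [this]
  refine .disjUnion (.path ?_) (.path ?_) ?_
  · simp; grind
  · simp; grind
  · simp [pathEdges]; grind

/-- A graph with at least four vertices, two of which are adjacent to all others, can be
decomposed into paths with three edges as soon as its number of edges is divisible by three. -/
theorem pathDecomposable_cone {x y : α} (hxy : x ≠ y) {S : Finset α} {F : Finset (Sym2 α)}
    (hx : x ∉ S) (hy : y ∉ S) (hd : ∀ e ∈ F, ¬ e.IsDiag) (hF : ∀ e ∈ F, ∀ w ∈ e, w ∈ S)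
    (hS : 2 ≤ S.card) (h3 : 3 ∣ F.card + 2 * S.card + 1) :
    PathDecomposable (insert s(x, y) (cone x y S F)) := by
  induction hN : S.card + F.card using Nat.strong_induction_on generalizing S F with
  | _ N ih =>
  -- The common reduction. Two vertices of `S` must survive: with only one, and `F` empty, the cone
  -- with `xy` is a triangle, which has three edges but is not a path.
  have step : ∀ (T : Finset α) (F' : Finset (Sym2 α)), T ⊆ S → F' ⊆ F →
      PathDecomposable (cone x y T F') → (∀ e ∈ F \ F', ∀ w ∈ e, w ∉ T) →
      2 + T.card ≤ S.card → 3 ∣ F'.card + 2 * T.card → 0 < F'.card + T.card →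
      PathDecomposable (insert s(x, y) (cone x y S F)) := by
    intro T F' hT hF' h hFT hc hdvd hpos
    have c1 := Finset.card_sdiff_add_card_eq_card hT
    have c2 := Finset.card_sdiff_add_card_eq_card hF'
    refine pathDecomposable_cone_of_sdiff hxy hx hy hF hT hF' h
      (ih ((S \ T).card + (F \ F').card) (by omega) ?_ ?_ ?_ ?_ (by omega) (by omega) rfl)
    · exact fun h => hx (Finset.mem_sdiff.1 h).1
    · exact fun h => hy (Finset.mem_sdiff.1 h).1
    · exact fun e he => hd e (Finset.mem_sdiff.1 he).1
    · exact fun e he w hw => Finset.mem_sdiff.2 ⟨hF e (Finset.mem_sdiff.1 he).1 w hw, hFT e he w hw⟩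
  have ne : ∀ {a b}, s(a, b) ∈ F → a ≠ b := fun h => by simpa using hd _ h
  have meml : ∀ {a b}, s(a, b) ∈ F → a ∈ S := fun h => hF _ h _ (Sym2.mem_mk_left _ _)
  have memr : ∀ {a b}, s(a, b) ∈ F → b ∈ S := fun h => hF _ h _ (Sym2.mem_mk_right _ _)
  have nex : ∀ {a}, a ∈ S → x ≠ a := fun h h' => hx (h' ▸ h)
  have ney : ∀ {a}, a ∈ S → y ≠ a := fun h h' => hy (h' ▸ h)
  have comm : ∀ {a b}, s(a, b) ∈ F → s(b, a) ∈ F := fun h => by rwa [Sym2.eq_swap]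
  by_cases hP : ∃ a b c d, [a, b, c, d].Nodup ∧ s(a, b) ∈ F ∧ s(b, c) ∈ F ∧ s(c, d) ∈ F
  · obtain ⟨a, b, c, d, hn, hab, hbc, hcd⟩ := hP
    refine step ∅ (pathEdges a b c d) (by simp) ?_ ?_ (by simp) (by simpa using hS) ?_ ?_
    · simp [pathEdges, Finset.insert_subset_iff, *]
    · simpa [cone] using PathDecomposable.path hn
    · simp [card_pathEdges hn]
    · simp [card_pathEdges hn]
  -- From here on `F` contains no three-edge path, so its nontrivial components are triangles and
  -- stars.
  have noP : ∀ {a b c d}, s(a, b) ∈ F → s(b, c) ∈ F → s(c, d) ∈ F → a = c ∨ a = d ∨ b = d := by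
    intro a b c d hab hbc hcd
    have h1 := ne hab
    have h2 := ne hbc
    have h3 := ne hcd
    by_contra! h
    exact hP ⟨a, b, c, d, by simp; grind, hab, hbc, hcd⟩
  by_cases hT : ∃ a b c, s(a, b) ∈ F ∧ s(b, c) ∈ F ∧ s(c, a) ∈ F
  · obtain ⟨a, b, c, hab, hbc, hca⟩ := hT
    have h1 := ne hab
    have h2 := ne hbc
    have h3' := ne hca
    -- A further edge at the triangle would create a three-edge path, so the triangle is a whole
    -- component.
    have hFT : ∀ e ∈ F \ {s(a, b), s(b, c), s(c, a)}, ∀ w ∈ e, w ∉ ({a, b, c} : Finset α) := by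
      intro e he w hw hw'
      obtain ⟨u, rfl⟩ := Sym2.mem_iff_exists.1 hw
      simp only [Finset.mem_sdiff, Finset.mem_insert, Finset.mem_singleton, Sym2.eq_iff] at he hw'
      obtain ⟨he, hne⟩ := he
      have h4 := ne he
      rcases hw' with rfl | rfl | rfl
      · have := noP (comm he) hab hbc
        grind
      · have := noP (comm he) hbc hca
        grind
      · have := noP (comm he) hca hab
        grind
    have hsub : ({a, b, c} : Finset α) ⊆ S := by
      simp [Finset.insert_subset_iff, meml hab, meml hbc, meml hca]
    have hsubF : ({s(a, b), s(b, c), s(c, a)} : Finset (Sym2 α)) ⊆ F := by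
      simp [Finset.insert_subset_iff, *]
    have cT : ({a, b, c} : Finset α).card = 3 := Finset.card_eq_three.2 ⟨a, b, c, h1, h3'.symm, h2, rfl⟩
    have cF : ({s(a, b), s(b, c), s(c, a)} : Finset (Sym2 α)).card = 3 :=
      Finset.card_eq_three.2 ⟨_, _, _, by simp; grind, by simp; grind, by simp; grind, rfl⟩
    have cS := Finset.card_sdiff_add_card_eq_card hsub
    have na := nex (meml hab)
    have nb := nex (meml hbc)
    have nc := nex (meml hca)
    have na' := ney (meml hab)
    have nb' := ney (meml hbc)
    have nc' := ney (meml hca)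
    by_cases h5 : 5 ≤ S.card
    · refine step _ _ hsub hsubF (pathDecomposable_cone_triangle ?_) hFT (by omega) (by omega)
        (by omega)
      simp; grind
    · have hd' : ∀ e ∈ F, e ∉ ({s(a, b), s(b, c), s(c, a)} : Finset (Sym2 α)) →
          ∀ w ∈ e, w ∈ S \ {a, b, c} := fun e he he' w hw =>
        Finset.mem_sdiff.2 ⟨hF e he w hw, hFT e (Finset.mem_sdiff.2 ⟨he, he'⟩) w hw⟩
      have hFe : F = {s(a, b), s(b, c), s(c, a)} := by
        refine Finset.Subset.antisymm (fun e he => ?_) hsubF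
        by_contra hne
        induction e with | _ u w =>
        have := Finset.card_le_one.1 (show (S \ {a, b, c}).card ≤ 1 by omega) u
          (hd' _ he hne u (by simp)) w (hd' _ he hne w (by simp))
        exact ne he this
      -- If `|S| = 3` there would be `3 + 6 + 1 = 10` edges, not a multiple of three.
      have c4 : (S \ {a, b, c}).card = 1 := by rw [hFe, cF] at h3; omega
      obtain ⟨d, hd0⟩ := Finset.card_eq_one.1 c4
      have hdS : d ∈ S \ {a, b, c} := by simp [hd0]
      have hSe : S = {a, b, c, d} := by
        rw [← Finset.union_sdiff_of_subset hsub, hd0]; ext; simp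
      simp only [Finset.mem_sdiff, Finset.mem_insert, Finset.mem_singleton] at hdS
      have nd := nex hdS.1
      have nd' := ney hdS.1
      rw [hSe, hFe]
      exact pathDecomposable_cone_triangle_isolated (by simp; grind)
  -- Two leaves `a`, `b` with neighbours `z`, `w`; `z ≠ b` and `w ≠ a` exclude the two ends of one
  -- isolated edge.
  by_cases hL : ∃ a b z w, a ≠ b ∧ z ≠ b ∧ w ≠ a ∧ s(z, a) ∈ F ∧ s(w, b) ∈ F ∧
      (∀ u, s(u, a) ∈ F → u = z) ∧ (∀ u, s(u, b) ∈ F → u = w)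
  · obtain ⟨a, b, z, w, hab, hzb, hwa, hza, hwb, ha, hb⟩ := hL
    have h1 := ne hza
    have h2 := ne hwb
    have na := nex (memr hza)
    have nb := nex (memr hwb)
    have nz := nex (meml hza)
    have nw := nex (meml hwb)
    have na' := ney (memr hza)
    have nb' := ney (memr hwb)
    have nz' := ney (meml hza)
    have nw' := ney (meml hwb)
    have hFT : ∀ e ∈ F \ {s(z, a), s(w, b)}, ∀ u ∈ e, u ∉ ({a, b} : Finset α) := by
      intro e he u hu hu'
      obtain ⟨t, rfl⟩ := Sym2.mem_iff_exists.1 hu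
      simp only [Finset.mem_sdiff, Finset.mem_insert, Finset.mem_singleton, Sym2.eq_iff] at he hu'
      obtain ⟨he, hne⟩ := he
      rcases hu' with rfl | rfl
      · have := ha _ (comm he)
        grind
      · have := hb _ (comm he)
        grind
    have hsub : ({a, b} : Finset α) ⊆ S := by
      simp [Finset.insert_subset_iff, memr hza, memr hwb]
    have hsubF : ({s(z, a), s(w, b)} : Finset (Sym2 α)) ⊆ F := by
      simp [Finset.insert_subset_iff, *]
    have cT : ({a, b} : Finset α).card = 2 := Finset.card_pair hab
    have cF : ({s(z, a), s(w, b)} : Finset (Sym2 α)).card = 2 :=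
      Finset.card_pair (by simp; grind)
    have cS := Finset.card_sdiff_add_card_eq_card hsub
    by_cases h4 : 4 ≤ S.card
    · refine step _ _ hsub hsubF (pathDecomposable_cone_pair ?_ ?_ ?_) hFT (by omega) (by omega)
        (by omega)
      · simp; grind
      · simp; grind
      · simp; grind
    -- With only three vertices in `S`, both leaves hang on the same centre.
    · have hz : z ∈ S \ {a, b} := by simp [meml hza]; grind
      have hw : w ∈ S \ {a, b} := by simp [meml hwb]; grind
      have hle : (S \ {a, b}).card ≤ 1 := by omega
      obtain rfl := Finset.card_le_one.1 hle z hz w hw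
      have hFe : F = {s(z, a), s(z, b)} := by
        refine Finset.Subset.antisymm (fun e he => ?_) hsubF
        by_contra hne
        induction e with | _ u w =>
        have hm := hFT _ (Finset.mem_sdiff.2 ⟨he, hne⟩)
        have := Finset.card_le_one.1 hle u
          (Finset.mem_sdiff.2 ⟨meml he, hm u (by simp)⟩) w
          (Finset.mem_sdiff.2 ⟨memr he, hm w (by simp)⟩)
        exact ne he this
      have hSe : S = {z, a, b} := by
        rw [← Finset.union_sdiff_of_subset hsub,
          Finset.eq_singleton_iff_unique_mem.2 ⟨hz, fun u hu => Finset.card_le_one.1 hle u hu z hz⟩]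
        ext; simp; tauto
      rw [hSe, hFe]
      exact pathDecomposable_cone_star (by simp; grind)
  have hF1 : F.card ≤ 1 := by
    -- With paths and triangles excluded, two neighbours of one vertex would be leaves, so `F` is a
    -- matching; two of its edges would again supply two leaves.
    have hnb : ∀ {z a b}, s(z, a) ∈ F → s(z, b) ∈ F → a = b := by
      intro z a b hza hzb
      by_contra hab
      refine hL ⟨a, b, z, z, hab, ne hzb, ne hza, hza, hzb, fun u hu => ?_, fun u hu => ?_⟩
      · rcases noP hu (comm hza) hzb with h | rfl | h
        · exact h
        · exact absurd ⟨z, u, a, hzb, hu, comm hza⟩ hT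
        · exact absurd h hab
      · rcases noP hu (comm hzb) hza with h | rfl | h
        · exact h
        · exact absurd ⟨z, u, b, hza, hu, comm hzb⟩ hT
        · exact absurd h.symm hab
    refine Finset.card_le_one.2 fun e he f hf => ?_
    induction e with | _ z a =>
    induction f with | _ w b =>
    by_contra hne
    have hab : a ≠ b := by
      rintro rfl
      exact hne (by rw [hnb (comm he) (comm hf)])
    have hzb : z ≠ b := by
      rintro rfl
      exact hne (by rw [hnb he (comm hf), Sym2.eq_swap])
    have hwa : w ≠ a := by
      rintro rfl
      exact hne (by rw [hnb (comm he) hf, Sym2.eq_swap])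
    exact hL ⟨a, b, z, w, hab, hzb, hwa, he, hf, fun u hu => hnb (comm hu) (comm he),
      fun u hu => hnb (comm hu) (comm hf)⟩
  have three : ∀ T ⊆ S, T.card = 3 → (∀ e ∈ F, ∀ w ∈ e, w ∉ T) → 5 ≤ S.card →
      PathDecomposable (insert s(x, y) (cone x y S F)) := by
    intro T hTS hT3 hFT h5
    refine step T ∅ hTS (by simp) ?_ (by simpa using hFT) (by omega) (by simp [hT3]) (by omega)
    obtain ⟨a, b, c, hab, hac, hbc, rfl⟩ := Finset.card_eq_three.1 hT3
    simp only [Finset.insert_subset_iff, Finset.singleton_subset_iff] at hTS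
    obtain ⟨ha, hb, hc⟩ := hTS
    have := nex ha
    have := nex hb
    have := nex hc
    have := ney ha
    have := ney hb
    have := ney hc
    exact pathDecomposable_cone_empty_three (by simp; grind)
  rcases Nat.le_one_iff_eq_zero_or_eq_one.1 hF1 with h0 | h1
  · obtain rfl := Finset.card_eq_zero.1 h0
    by_cases h5 : 5 ≤ S.card
    · obtain ⟨T, hTS, hT3⟩ := Finset.exists_subset_card_eq (show 3 ≤ S.card by omega)
      exact three T hTS hT3 (by simp) h5
    -- Among `2, 3, 4`, only `|S| = 4` makes `2|S| + 1` divisible by three.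
    · obtain ⟨a, b, c, d, _, _, _, _, _, _, rfl⟩ := Finset.card_eq_four.1
        (show S.card = 4 by simp at h3; omega)
      simp only [Finset.mem_insert, Finset.mem_singleton] at hx hy
      exact pathDecomposable_cone_empty_four (by simp; grind)
  · obtain ⟨e, rfl⟩ := Finset.card_eq_one.1 h1
    induction e with | _ z a =>
    have he : s(z, a) ∈ ({s(z, a)} : Finset (Sym2 α)) := by simp
    have hza := ne he
    have hsub : ({z, a} : Finset α) ⊆ S := by
      simp [Finset.insert_subset_iff, meml he, memr he]
    have cS := Finset.card_sdiff_add_card_eq_card hsub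
    rw [Finset.card_pair hza] at cS
    rw [h1] at h3
    by_cases h5 : 5 ≤ S.card
    · obtain ⟨T, hTS, hT3⟩ := Finset.exists_subset_card_eq (show 3 ≤ (S \ {z, a}).card by omega)
      refine three T (hTS.trans Finset.sdiff_subset) hT3 ?_ h5
      simp only [Finset.mem_singleton, forall_eq]
      intro w hw hwT
      have := hTS hwT
      simp at this hw
      tauto
    -- Now `2|S| + 2` must be divisible by three, which forces `|S| = 2`.
    · have hSe : S = {z, a} :=
        (Finset.eq_of_subset_of_card_le hsub (by rw [Finset.card_pair hza]; omega)).symm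
      have := nex (meml he)
      have := ney (meml he)
      have := nex (memr he)
      have := ney (memr he)
      rw [hSe]
      exact pathDecomposable_cone_edge (by simp; grind)

end PathDecomposable

/-! ### From edge sets to designs and down-links -/

section Designs

open SimpleGraph

variable {U : Type*}

theorem mem_edgeSet_completeOn {V : Finset U} {a b : U} :
    s(a, b) ∈ (completeOn V).edgeSet ↔ a ∈ V ∧ b ∈ V ∧ a ≠ b := by
  simp [completeOn]

/-- Isolated vertices are the only obstruction; this is why `IsPathPartition` carries the field
`verts`. -/
theorem le_of_edgeSet_subset {G : SimpleGraph U} {A B : G.Subgraph}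
    (hA : ∀ w ∈ A.verts, ∃ e ∈ A.edgeSet, w ∈ e) (h : A.edgeSet ⊆ B.edgeSet) : A ≤ B := by
  refine ⟨fun w hw => ?_, fun u w huw => Subgraph.mem_edgeSet.1 (h (Subgraph.mem_edgeSet.2 huw))⟩
  obtain ⟨e, he, hwe⟩ := hA w hw
  exact B.mem_verts_of_mem_edge (h he) hwe

/-- A set of paths with three edges whose edge sets partition `E`. -/
structure IsPathPartition (E : Set (Sym2 U)) (𝓠 : Set (⊤ : SimpleGraph U).Subgraph) : Prop where
  iso : ∀ B ∈ 𝓠, Nonempty (B.coe ≃g pathGraph 4)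
  verts : ∀ B ∈ 𝓠, ∀ w ∈ B.verts, ∃ e ∈ B.edgeSet, w ∈ e
  subset : ∀ B ∈ 𝓠, B.edgeSet ⊆ E
  partition : ∀ e ∈ E, ∃! B, B ∈ 𝓠 ∧ e ∈ B.edgeSet

namespace IsPathPartition

theorem union {E F : Set (Sym2 U)} {𝓠 𝓡 : Set (⊤ : SimpleGraph U).Subgraph}
    (hE : IsPathPartition E 𝓠) (hF : IsPathPartition F 𝓡) (h : Disjoint E F) :
    IsPathPartition (E ∪ F) (𝓠 ∪ 𝓡) where
  iso B hB := hB.elim (hE.iso B) (hF.iso B)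
  verts B hB := hB.elim (hE.verts B) (hF.verts B)
  subset B hB := hB.elim (fun h => (hE.subset B h).trans Set.subset_union_left)
    (fun h => (hF.subset B h).trans Set.subset_union_right)
  partition e he := by
    rw [Set.disjoint_left] at h
    rcases he with he | he
    · obtain ⟨B, ⟨hB, heB⟩, hu⟩ := hE.partition e he
      refine ⟨B, ⟨.inl hB, heB⟩, ?_⟩
      rintro C ⟨hC | hC, heC⟩
      · exact hu C ⟨hC, heC⟩
      · exact absurd (hF.subset C hC heC) (h he)
    · obtain ⟨B, ⟨hB, heB⟩, hu⟩ := hF.partition e he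
      refine ⟨B, ⟨.inr hB, heB⟩, ?_⟩
      rintro C ⟨hC | hC, heC⟩
      · exact absurd he (h (hE.subset C hC heC))
      · exact hu C ⟨hC, heC⟩

theorem isDesign {W : Finset U} {𝓠 : Set (⊤ : SimpleGraph U).Subgraph}
    (h : IsPathPartition (completeOn W).edgeSet 𝓠) :
    IsDesign (completeOn W) (pathGraph 4) 𝓠 where
  le B hB := le_of_edgeSet_subset (h.verts B hB) (h.subset B hB)
  iso := h.iso
  partition := h.partition

end IsPathPartition

theorem exists_isPathPartition_singleton [DecidableEq U] {a b c d : U}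
    (h : [a, b, c, d].Nodup) :
    ∃ B, IsPathPartition (pathEdges a b c d : Set (Sym2 U)) {B} ∧
      B.edgeSet = (pathEdges a b c d : Set (Sym2 U)) := by
  simp at h
  have hinj : Function.Injective ![a, b, c, d] := by
    intro i j hij
    fin_cases i <;> fin_cases j <;> simp at hij ⊢ <;> grind
  let f : Copy (pathGraph 4) (⊤ : SimpleGraph U) :=
    ⟨⟨![a, b, c, d], fun {i j} hij => by simpa using hinj.ne hij.ne⟩, hinj⟩
  have hedge : f.toSubgraph.edgeSet = (pathEdges a b c d : Set (Sym2 U)) := by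
    ext e
    induction e with | _ u w =>
    simp only [Copy.toSubgraph, Subgraph.edgeSet_map, Set.mem_image, pathEdges]
    constructor
    · rintro ⟨e, he, heq⟩
      rw [← heq]
      induction e with | _ i j =>
      simp [pathGraph_adj] at he
      fin_cases i <;> fin_cases j <;> simp at he <;> simp [f]
    · intro he
      simp only [Finset.coe_insert, Finset.coe_singleton, Set.mem_insert_iff,
        Set.mem_singleton_iff] at he
      rcases he with he | he | he <;> rw [he]
      · exact ⟨s(0, 1), by simp [pathGraph_adj], by simp [f]⟩
      · exact ⟨s(1, 2), by simp [pathGraph_adj], by simp [f]⟩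
      · exact ⟨s(2, 3), by simp [pathGraph_adj], by simp [f]⟩
  refine ⟨f.toSubgraph, ⟨?_, ?_, ?_, ?_⟩, hedge⟩
  · rintro _ rfl
    exact ⟨f.isoToSubgraph.symm⟩
  · rintro _ rfl w hw
    rw [hedge]
    simp only [Copy.toSubgraph, Subgraph.map_verts, Subgraph.verts_top, Set.image_univ,
      Set.mem_range] at hw
    obtain ⟨i, rfl⟩ := hw
    fin_cases i <;> simp [pathEdges, f]
  · rintro _ rfl
    exact hedge.le
  · intro e he
    exact ⟨_, ⟨rfl, hedge ▸ he⟩, fun C hC => hC.1⟩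

theorem PathDecomposable.exists_isPathPartition [DecidableEq U] {E : Finset (Sym2 U)}
    (hE : PathDecomposable E) : ∃ 𝓠, IsPathPartition (E : Set (Sym2 U)) 𝓠 := by
  induction hE with
  | empty => exact ⟨∅, by simp, by simp, by simp, by simp⟩
  | union hp hd _ ih =>
    obtain ⟨𝓠, h𝓠⟩ := ih
    obtain ⟨B, hB, -⟩ := exists_isPathPartition_singleton hp
    exact ⟨_, by simpa using hB.union h𝓠 (by simpa using hd)⟩

/-- In a cycle of length greater than `4 * #Z` there is a path with three edges avoiding `Z`. -/
theorem exists_path_avoiding {k : ℕ} (hk : 4 ≤ k) {G : SimpleGraph U} {B : G.Subgraph}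
    (φ : B.coe ≃g cycleGraph k) (Z : Finset U) (hZ : 4 * Z.card < k) :
    ∃ a b c d, [a, b, c, d].Nodup ∧ a ∉ Z ∧ b ∉ Z ∧ c ∉ Z ∧ d ∉ Z ∧
      s(a, b) ∈ B.edgeSet ∧ s(b, c) ∈ B.edgeSet ∧ s(c, d) ∈ B.edgeSet := by
  classical
  obtain ⟨p, rfl⟩ := Nat.exists_eq_add_of_le' hk
  let g : Fin (p + 4) → U := fun i => (φ.symm i : U)
  have hg : Function.Injective g := Subtype.val_injective.comp φ.symm.injective
  have hadj : ∀ i, s(g i, g (i + 1)) ∈ B.edgeSet := by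
    intro i
    have : B.coe.Adj (φ.symm i) (φ.symm (i + 1)) := by
      rw [φ.symm.map_adj_iff, cycleGraph_adj]
      right
      simp
    exact this
  -- For a fixed offset `j`, each vertex of `Z` spoils at most one starting point `i`; four offsets
  -- spoil at most `4 * Z.card < k` of them.
  have hbad : ∀ j, (Finset.univ.filter fun i => g (i + j) ∈ Z).card ≤ Z.card := fun j =>
    Finset.card_le_card_of_injOn (fun i => g (i + j)) (by intro i; simp)
      (fun i _ i' _ h => add_right_cancel (hg h))
  obtain ⟨i, hi⟩ : ∃ i, i ∉ (Finset.univ : Finset (Fin 4)).biUnion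
      fun j => Finset.univ.filter fun i => g (i + Fin.castLE hk j) ∈ Z := by
    by_contra! h
    have h1 := Finset.card_biUnion_le_card_mul (Finset.univ : Finset (Fin 4)) _ Z.card
      (fun j _ => hbad (Fin.castLE hk j))
    rw [Finset.eq_univ_iff_forall.2 h] at h1
    simp at h1
    omega
  simp only [Finset.mem_biUnion, Finset.mem_univ, true_and, Finset.mem_filter, not_exists] at hi
  have e0 : i + Fin.castLE hk 0 = i := by simp
  have e1 : i + Fin.castLE hk 1 = i + 1 := by simp [Fin.ext_iff]
  have e2 : i + Fin.castLE hk 2 = i + 1 + 1 := by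
    rw [add_assoc]; congr 1
  have e3 : i + Fin.castLE hk 3 = i + 1 + 1 + 1 := by
    rw [add_assoc, add_assoc]; congr 1
  have h0 := hi 0
  have h1 := hi 1
  have h2 := hi 2
  have h3 := hi 3
  have hne : ∀ {j l : Fin 4}, j ≠ l → g (i + Fin.castLE hk j) ≠ g (i + Fin.castLE hk l) :=
    fun h h' => h (Fin.castLE_injective hk (add_left_cancel (hg h')))
  refine ⟨_, _, _, _, ?_, h0, h1, h2, h3, ?_, ?_, ?_⟩
  · simp only [List.nodup_cons, List.mem_cons, List.not_mem_nil, or_false, not_or,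
      not_false_eq_true, List.nodup_nil, and_true]
    exact ⟨⟨hne (by decide), hne (by decide), hne (by decide)⟩, ⟨hne (by decide), hne (by decide)⟩,
      hne (by decide)⟩
  · rw [e0, e1]; exact hadj i
  · rw [e1, e2]; exact hadj _
  · rw [e2, e3]; exact hadj _

theorem pathGraph_isContained_cycleGraph {m k : ℕ} (h : m ≤ k) :
    (pathGraph m).IsContained (cycleGraph k) :=
  ⟨⟨⟨Fin.castLE h, fun {i j} hij => pathGraph_le_cycleGraph (by
    rw [pathGraph_adj] at hij ⊢; exact hij)⟩, Fin.castLE_injective h⟩⟩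

theorem IsDesign.eq_of_mem {T : Type*} {K : (⊤ : SimpleGraph U).Subgraph} {Γ : SimpleGraph T}
    {𝓑 : Set (⊤ : SimpleGraph U).Subgraph} (h : IsDesign K Γ 𝓑) {B C : 𝓑} {e : Sym2 U}
    (hB : e ∈ B.1.edgeSet) (hC : e ∈ C.1.edgeSet) : B = C :=
  Subtype.ext <| (h.partition e (Subgraph.edgeSet_mono (h.le B B.2) hB)).unique
    ⟨B.2, hB⟩ ⟨C.2, hC⟩

/-- A design of a complete graph with at least one edge has blocks, so their order is at most
that of the design. -/
theorem IsDesign.le_card {k : ℕ} {Γ : SimpleGraph (Fin k)} {V : Finset U}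
    {𝓑 : Set (⊤ : SimpleGraph U).Subgraph} (h : IsDesign (completeOn V) Γ 𝓑) (hV : 1 < V.card) :
    k ≤ V.card := by
  obtain ⟨a, ha, b, hb, hab⟩ := Finset.one_lt_card.1 hV
  obtain ⟨B, ⟨hB, -⟩, -⟩ := h.partition s(a, b) (mem_edgeSet_completeOn.2 ⟨ha, hb, hab⟩)
  obtain ⟨φ⟩ := h.iso B hB
  have hsub : B.verts ⊆ V := by simpa [completeOn] using (h.le B hB).1
  have := Nat.card_mono V.finite_toSet hsub
  rw [Nat.card_congr φ.toEquiv] at this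
  simpa using this

/-- Nesting makes `V \ W` as small as possible. -/
theorem exists_card_eq_subset_or_superset [Infinite U] (V : Finset U) (n : ℕ) :
    ∃ W : Finset U, W.card = n ∧ (W ⊆ V ∨ V ⊆ W) := by
  rcases le_total n V.card with h | h
  · obtain ⟨W, h1, h2⟩ := Finset.exists_subset_card_eq h
    exact ⟨W, h2, .inl h1⟩
  · obtain ⟨W, h1, h2⟩ := Infinite.exists_superset_card_eq V n h
    exact ⟨W, h2, .inr h1⟩

theorem three_dvd_choose_two {n : ℕ} (h : n ≡ 0 [MOD 3] ∨ n ≡ 1 [MOD 3]) : 3 ∣ n.choose 2 := by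
  have h2 : 3 ∣ 2 * n.choose 2 := by
    rw [Nat.choose_two_right, Nat.mul_div_cancel' (Nat.even_mul_pred_self n).two_dvd]
    rcases h with h | h
    · exact ((Nat.modEq_zero_iff_dvd).1 h).mul_right _
    · rcases Nat.eq_zero_or_pos n with rfl | hn
      · simp
      · exact ((Nat.modEq_iff_dvd' hn).1 h.symm).mul_left _
  omega

/-- Any family of edge-disjoint paths with three edges in a complete graph of admissible order that
misses two of its vertices extends to a design. -/
theorem exists_design_of_edgeDisjoint_paths {ι : Type*} {W : Finset U} {x y : U} (hxW : x ∈ W)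
    (hyW : y ∈ W) (hxy : x ≠ y) (hW : 4 ≤ W.card)
    (hmod : W.card ≡ 0 [MOD 3] ∨ W.card ≡ 1 [MOD 3]) {a b c d : ι → U}
    (hp : ∀ i, [a i, b i, c i, d i].Nodup)
    (hS : ∀ i, ∀ w ∈ [a i, b i, c i, d i], w ∈ W ∧ w ≠ x ∧ w ≠ y)
    (hdisj : ∀ i j, ∀ e ∈ ({s(a i, b i), s(b i, c i), s(c i, d i)} : Set (Sym2 U)),
      e ∈ ({s(a j, b j), s(b j, c j), s(c j, d j)} : Set (Sym2 U)) → i = j) :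
    ∃ (𝓠 : Set (⊤ : SimpleGraph U).Subgraph) (P : ι → 𝓠),
      IsDesign (completeOn W) (pathGraph 4) 𝓠 ∧
      ∀ i, (∀ w ∈ (P i).1.verts, ∃ e ∈ (P i).1.edgeSet, w ∈ e) ∧
        (P i).1.edgeSet = {s(a i, b i), s(b i, c i), s(c i, d i)} := by
  classical
  set p : ι → Finset (Sym2 U) := fun i => pathEdges (a i) (b i) (c i) (d i) with hpdef
  have hpc : ∀ i, (p i : Set (Sym2 U)) = {s(a i, b i), s(b i, c i), s(c i, d i)} := by
    simp [p, pathEdges]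
  simp_rw [← hpc] at hdisj ⊢
  choose P hP hPe using fun i => exists_isPathPartition_singleton (hp i)
  set S := (W.erase x).erase y with hSdef
  have hcS : S.card + 2 = W.card := by
    rw [hSdef, Finset.card_erase_of_mem (Finset.mem_erase.2 ⟨hxy.symm, hyW⟩),
      Finset.card_erase_of_mem hxW]
    omega
  have hmS : ∀ {w}, w ∈ S ↔ w ∈ W ∧ w ≠ x ∧ w ≠ y := by
    intro w; simp [S]; tauto
  set E : Finset (Sym2 U) := S.offDiag.image Sym2.mk.uncurry with hE
  have hmE : ∀ {u w}, s(u, w) ∈ E ↔ u ∈ S ∧ w ∈ S ∧ u ≠ w := by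
    intro u w
    simp only [hE, Finset.mem_image, Finset.mem_offDiag, Prod.exists, Function.uncurry_apply_pair,
      Sym2.eq_iff]
    grind
  have hpE : ∀ i, p i ⊆ E := by
    intro i
    have h1 := hS i
    have h2 := hp i
    simp at h1 h2
    simp only [p, pathEdges, Finset.insert_subset_iff, Finset.singleton_subset_iff, hmE, hmS]
    grind
  have hpcard : ∀ i, (p i).card = 3 := fun i => card_pathEdges (hp i)
  -- Each path owns an edge of the finite set `E`, so there are finitely many.
  have hfin : Finite ι := by
    have hne : ∀ i, (p i).Nonempty := fun i => Finset.card_pos.1 (by rw [hpcard]; norm_num)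
    choose e he using hne
    exact Finite.of_injective (fun i => (⟨e i, hpE i (he i)⟩ : E)) fun i j hij =>
      hdisj i j (e i) (he i) (by rw [Subtype.mk.inj hij]; exact he j)
  have := Fintype.ofFinite ι
  set D := Finset.univ.biUnion p with hD
  have hDE : D ⊆ E := Finset.biUnion_subset.2 fun i _ => hpE i
  have hcD : 3 ∣ D.card := by
    rw [hD, Finset.card_biUnion, Finset.sum_congr rfl fun i _ => hpcard i]
    · simp
    · exact fun i _ j _ hij => Finset.disjoint_left.2 fun e hi hj => hij (hdisj i j e hi hj)
  have hcE : E.card = S.card.choose 2 := Sym2.card_image_offDiag S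
  have hch := three_dvd_choose_two hmod
  -- With `s = |S|`, the complete graph on `W` has `(s + 1) + s + s.choose 2` edges; as 3 divides
  -- `|D|`, it divides the number left over.
  rw [← hcS, Nat.choose_succ_succ' (S.card + 1) 1, Nat.choose_succ_succ' S.card 1] at hch
  simp only [Nat.choose_one_right, Nat.reduceAdd] at hch
  have hcF := Finset.card_sdiff_add_card_eq_card hDE
  have hx : x ∉ S := fun h => (hmS.1 h).2.1 rfl
  have hy : y ∉ S := fun h => (hmS.1 h).2.2 rfl
  obtain ⟨𝓠, h𝓠⟩ := (pathDecomposable_cone hxy hx hy (F := E \ D) (by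
    intro e he
    induction e with | _ u w =>
    exact (hmE.1 (Finset.mem_sdiff.1 he).1).2.2) (by
    intro e he t ht
    induction e with | _ u w =>
    have := hmE.1 (Finset.mem_sdiff.1 he).1
    rcases Sym2.mem_iff.1 ht with rfl | rfl
    · exact this.1
    · exact this.2.1) (by omega) (by omega)).exists_isPathPartition
  have hPD : IsPathPartition (D : Set (Sym2 U)) (Set.range P) := by
    refine ⟨?_, ?_, ?_, ?_⟩
    · rintro _ ⟨i, rfl⟩
      exact (hP i).iso _ rfl
    · rintro _ ⟨i, rfl⟩
      exact (hP i).verts _ rfl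
    · rintro _ ⟨i, rfl⟩
      rw [hPe]
      exact Finset.coe_subset.2 (Finset.subset_biUnion_of_mem p (Finset.mem_univ i))
    · intro e he
      obtain ⟨i, -, hi⟩ := Finset.mem_biUnion.1 (Finset.mem_coe.1 he)
      refine ⟨P i, ⟨⟨i, rfl⟩, by rw [hPe]; exact hi⟩, ?_⟩
      rintro _ ⟨⟨j, rfl⟩, hj⟩
      rw [hPe] at hj
      rw [hdisj i j e hi hj]
  have htot := hPD.union h𝓠 (by
    rw [Finset.disjoint_coe, Finset.disjoint_left]
    intro e he he'
    have heE := hDE he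
    simp only [Finset.mem_insert, mem_cone, Finset.mem_sdiff] at he'
    rcases he' with rfl | ⟨t, -, rfl⟩ | ⟨t, -, rfl⟩ | h
    · exact hx (hmE.1 heE).1
    · exact hx (hmE.1 heE).1
    · exact hy (hmE.1 heE).1
    · exact h.2 he)
  have hset : (D : Set (Sym2 U)) ∪ (insert s(x, y) (cone x y S (E \ D)) : Finset (Sym2 U)) =
      (completeOn W).edgeSet := by
    ext e
    induction e with | _ u w =>
    rw [mem_edgeSet_completeOn]
    simp only [Set.mem_union, Finset.mem_coe, Finset.mem_insert, mem_cone, Finset.mem_sdiff]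
    constructor
    · have key : s(u, w) ∈ E → u ∈ W ∧ w ∈ W ∧ u ≠ w := fun h => by
        have := hmE.1 h
        exact ⟨(hmS.1 this.1).1, (hmS.1 this.2.1).1, this.2.2⟩
      rintro (h | h | ⟨t, ht, h⟩ | ⟨t, ht, h⟩ | h)
      · exact key (hDE h)
      · rw [Sym2.eq_iff] at h
        grind
      · rw [Sym2.eq_iff] at h
        have := hmS.1 ht
        grind
      · rw [Sym2.eq_iff] at h
        have := hmS.1 ht
        grind
      · exact key h.1
    · rintro ⟨hu, hw, huw⟩
      by_cases h : s(u, w) ∈ E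
      · by_cases h' : s(u, w) ∈ D
        · exact .inl h'
        · exact .inr (.inr (.inr (.inr ⟨h, h'⟩)))
      · rw [hmE, hmS, hmS] at h
        simp only [Sym2.eq_iff, hmS]
        grind
  rw [hset] at htot
  exact ⟨_, fun i => ⟨P i, .inl ⟨i, rfl⟩⟩, htot.isDesign, fun i => ⟨(hP i).verts _ rfl, hPe i⟩⟩

theorem exists_isDownLink_of_cycle_design [Infinite U] {k n : ℕ} (hk : 9 ≤ k) {V : Finset U}
    {𝓑 : Set (⊤ : SimpleGraph U).Subgraph} (h𝓑 : IsDesign (completeOn V) (cycleGraph k) 𝓑)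
    (hV : 1 < V.card) (hn : 4 * V.card + 9 ≤ k + 4 * n) (hmod : n ≡ 0 [MOD 3] ∨ n ≡ 1 [MOD 3]) :
    ∃ W : Finset U, W.card = n ∧ ∃ (𝓑' : Set (⊤ : SimpleGraph U).Subgraph) (f : 𝓑 → 𝓑'),
      IsDownLink (completeOn V) (completeOn W) (cycleGraph k) (pathGraph 4) 𝓑 𝓑' f := by
  classical
  -- Combined with the bound on `n`, `k ≤ |V|` gives `4n ≥ 3|V| + 9 ≥ 36`, so `W` is large enough to
  -- contain `x` and `y` and to apply the extension result.
  have hkV := h𝓑.le_card hV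
  obtain ⟨W, rfl, hWV⟩ := exists_card_eq_subset_or_superset V n
  obtain ⟨x, hxW, y, hyW, hxy⟩ := Finset.one_lt_card.1 (show 1 < W.card by omega)
  have hZ : 4 * ((V \ W) ∪ {x, y}).card < k := by
    have h1 := Finset.card_union_le (V \ W) {x, y}
    rw [Finset.card_pair hxy] at h1
    rcases hWV with h | h
    · have := Finset.card_sdiff_add_card_eq_card h
      omega
    · rw [Finset.sdiff_eq_empty_iff_subset.2 h] at h1 ⊢
      rw [Finset.card_empty] at h1
      omega
  choose a b c d hnd ha hb hc hd hab hbc hcd using fun B : 𝓑 =>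
    exists_path_avoiding (by omega) (h𝓑.iso B B.2).some _ hZ
  have hle : ∀ (B : 𝓑) {u w}, s(u, w) ∈ B.1.edgeSet → u ∈ V ∧ w ∈ V := fun B u w h =>
    have := mem_edgeSet_completeOn.1 (Subgraph.edgeSet_mono (h𝓑.le B B.2) h)
    ⟨this.1, this.2.1⟩
  have hsub : ∀ B : 𝓑, ({s(a B, b B), s(b B, c B), s(c B, d B)} : Set (Sym2 U)) ⊆
      B.1.edgeSet := by
    intro B
    simp only [Set.insert_subset_iff, Set.singleton_subset_iff]
    exact ⟨hab B, hbc B, hcd B⟩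
  have hnot : ∀ {w}, w ∈ V → w ∉ (V \ W) ∪ {x, y} → w ∈ W ∧ w ≠ x ∧ w ≠ y := by
    intro w hw h
    simp at h
    tauto
  obtain ⟨𝓠, P, h𝓠, hP⟩ := exists_design_of_edgeDisjoint_paths hxW hyW hxy (by omega) hmod hnd
    (by
      intro B
      simp only [List.forall_mem_cons]
      exact ⟨hnot (hle B (hab B)).1 (ha B), hnot (hle B (hab B)).2 (hb B),
        hnot (hle B (hcd B)).1 (hc B), hnot (hle B (hcd B)).2 (hd B), by simp⟩)
    (fun B C e hB hC => h𝓑.eq_of_mem (hsub B hB) (hsub C hC))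
  refine ⟨W, rfl, 𝓠, P, h𝓑, h𝓠, pathGraph_isContained_cycleGraph (by omega), fun B => ?_⟩
  exact le_of_edgeSet_subset (hP B).1 ((hP B).2 ▸ hsub B)

end Designs

end DownLink

theorem theorem4p1 (U : Type*) [Infinite U] (k v : ℕ) (hk : 9 ≤ k)
    (hv : DownLink.Admissible U (SimpleGraph.cycleGraph k) v) :
    {n : ℕ | (v : ℤ) - ⌊((k : ℚ) - 9) / 4⌋ ≤ (n : ℤ) ∧ (n ≡ 0 [MOD 3] ∨ n ≡ 1 [MOD 3])} ⊆
        DownLink.L₂ U (SimpleGraph.cycleGraph k) (SimpleGraph.pathGraph 4) v ∧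
      DownLink.L₂ U (SimpleGraph.cycleGraph k) (SimpleGraph.pathGraph 4) v ⊆
        DownLink.L₁ U (SimpleGraph.cycleGraph k) (SimpleGraph.pathGraph 4) v := by
  obtain ⟨hv1, V₀, hV₀, 𝓑₀, h𝓑₀⟩ := hv
  refine ⟨?_, fun n hn => ⟨V₀, hV₀, 𝓑₀, h𝓑₀, hn V₀ hV₀ 𝓑₀ h𝓑₀⟩⟩
  rintro n ⟨hn, hmod⟩ V rfl 𝓑 h𝓑
  refine DownLink.exists_isDownLink_of_cycle_design hk h𝓑 hv1 ?_ hmod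
  -- An integer lies below the floor exactly when it lies below the fraction.
  have h1 : ((V.card : ℤ) - n : ℚ) ≤ ((k : ℚ) - 9) / 4 := by
    rw [← Int.cast_natCast (R := ℚ) n, ← Int.cast_sub, ← Int.le_floor]
    omega
  have h2 : (4 * V.card + 9 : ℚ) ≤ k + 4 * n := by
    push_cast at h1
    linarith
  exact_mod_cast h2
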